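/- Let $T=(V,E)$ be a tree with $n$ vertices and maximum degree at most $k$. The labels $l_1,\dots,l_n$ have true locations given by a bijection $M_T:\{l_1,\dots,l_n\}\to V$ and hypothesized locations given by an arbitrary map $M_H:\{l_1,\dots,l_n\}\to V$; both change with time, and both start from arbitrary configurations. In every time unit the tracking algorithm makes one step: starting with $l_1$, it asks an oracle about the label $l_i$ that it is currently processing, at the vertex $u=M_H(l_i)$. If $M_T(l_i)=u$, the oracle answers null and the algorithm passes on to the next label, cyclically ($l_1$ follows $l_n$). Otherwise the oracle returns the first edge $(u,v)$ of the path in $T$ from $u$ to $M_T(l_i)$, and the algorithm sets $M_H(l_i):=v$. The evolver is uniformly random and the algorithm has speedup factor $2$: at the end of every second time unit an edge of $T$ is chosen uniformly at random, independently of all earlier choices, and the true labels at its two endpoints are swapped. For $v\in V$ let $L_{\mathcal H,v}(t)$ be the set of labels $l$ with $M_H(l)=v$ after $t$ time units. Then, after a long enough time, every vertex of the hypothesis tree holds at most $O(\sqrt n)$ labels with high probability. Precisely: for every $k$ there are constants $C,c>0$ and a function $t_0:\mathbb N\to\mathbb N$, depending only on $k$, such that for all such $T$ with $n$ vertices, all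 initial labelings $M_T$, $M_H$, and every time $t\ge t_0(n)$, $$\Pr\Bigl[\,|L_{\mathcal H,v}(t)|\le C\sqrt n\ \text{ for all } v\in V\Bigr]\ \ge\ 1-e^{-c\sqrt n}.$$ -/

import Mathlib

open MeasureTheory ProbabilityTheory

namespace EvolvingTree

/-- A configuration of the whole system on the vertex set `V`, with labels `0, …, n - 1`:
the true labeling `M_T` (a bijection), the hypothesized labeling `M_H` (any map),
and the label that the tracking algorithm is currently processing. -/
structure State (n : ℕ) (V : Type*) where
  trueLoc : Fin n ≃ V
  hypLoc : Fin n → V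
  current : Fin n

variable {n : ℕ} {V : Type*} [DecidableEq V]

/-- The oracle for the target vertex `w` (where a label truly resides), probed at the vertex `u`:
`none` if `u = w`, and otherwise the edge `(u, v)` at `u` that begins the unique path from `u`
to `w` in the tree `T`; the edge is given by its other endpoint `v`. -/
noncomputable def oracleTo {T : SimpleGraph V} (hT : T.IsTree) (w u : V) : Option V :=
  if u = w then none else some (hT.existsUnique_path u w).choose.snd

/-- The answer of the oracle to the query `(l, u)` in the configuration `s`. -/
noncomputable def oracle {T : SimpleGraph V} (hT : T.IsTree) (s : State n V) (l : Fin n) (u : V) :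
    Option V :=
  oracleTo hT (s.trueLoc l) u

/-- One step of the tracking algorithm: query the current label at its hypothesized location.
If the answer is null, go on to the next label (cyclically; a full cycle is an iteration);
otherwise move the hypothesis of the current label along the returned edge. -/
noncomputable def algStep {T : SimpleGraph V} (hT : T.IsTree) (s : State n V) : State n V :=
  match oracle hT s s.current (s.hypLoc s.current) with
  | none => { s with current := finRotate n s.current }
  | some v => { s with hypLoc := Function.update s.hypLoc s.current v }

/-- The transposition of the two endpoints of an unordered pair of vertices. -/
def swapEnds (e : Sym2 V) : Equiv.Perm V :=
  Sym2.lift ⟨fun a b => Equiv.swap a b, fun a b => Equiv.swap_comm a b⟩ e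

/-- One step of the evolver: exchange the true labels at the two endpoints of `e`. -/
def evolverStep (e : Sym2 V) (s : State n V) : State n V :=
  { s with trueLoc := s.trueLoc.trans (swapEnds e) }

/-- The configuration after `t` time units, started from `s₀`, with (integer) speedup factor `c`:
the algorithm makes one step in every time unit, and the evolver makes one step at the end of
every `c`-th time unit, its `m`-th step (`m = 0, 1, …`) being a swap along the edge `e m`. -/
noncomputable def run {T : SimpleGraph V} (hT : T.IsTree) (c : ℕ) (e : ℕ → T.edgeSet)
    (s₀ : State n V) : ℕ → State n V
  | 0 => s₀
  | t + 1 =>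
    if c ∣ t + 1 then evolverStep (e (t / c) : Sym2 V) (algStep hT (run hT c e s₀ t))
    else algStep hT (run hT c e s₀ t)

/-- The set of labels that reside at the vertex `v` in the hypothesis tree. -/
def labelsAt (s : State n V) (v : V) : Finset (Fin n) :=
  {l | s.hypLoc l = v}

/-- `E 0, E 1, …` is a uniform random evolver on `T`: the edges that it picks are independent
and uniformly distributed on the edge set of `T`. -/
structure IsRandomEvolver {V : Type*} {Ω : Type*} [MeasurableSpace Ω] (T : SimpleGraph V)
    (μ : Measure Ω) (E : ℕ → Ω → T.edgeSet) : Prop where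
  measurableSet_eq : ∀ m e, MeasurableSet {ω | E m ω = e}
  indep : iIndepFun (m := fun _ => ⊤) E μ
  uniform : ∀ m e, μ {ω | E m ω = e} = (Nat.card T.edgeSet : ENNReal)⁻¹

end EvolvingTree

/-!
Let the potential of a configuration be the total distance of the hypothesized from the true
locations, minus `β` times the number of wrong labels. A query that is not answered by null lowers
the total distance by one. A random swap moves a label that is wrong at `v` closer to its hypothesis
along one of the `deg v` edges, and earns the bonus `β` along all edges for a label that is right.
So for `β ≤ 1 / (deg + 1)` a round of at least two queries and one swap has negative drift, up to
two units for each null answer.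

Null answers advance the algorithm. If there are `n` of them during `m` rounds, all labels have been
checked, and since a label is at distance `0` when checked, the total distance is then at most `2m`.
Otherwise the drift lowers the potential. Hence the exponential moment of the potential contracts to
`exp O(n)`. In a window of `O(n)` rounds starting from such a potential, all labels are checked up
to an exponentially small probability, because fewer than `n` null answers would push the potential
below its minimum `-n`.

After a window in which all labels were checked, a label hypothesized at `v`, unless it is being
processed, was truly at `v` when it last got a null answer. So the load of `v` is at most `2` plus
the number of swaps at `v` in the window. That number has an exponential moment bounded in terms of
`k`. The union bound over `v` then gives loads of order `log n + x` up to probability `exp (-x)`, of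
which `O(√n)` is a weak form.
-/

open scoped BigOperators

namespace EvolvingTree

section WordMean

variable {α : Type*} [Fintype α]

/-- The mean of `F` over all words of length `m` in the alphabet `α`: the expectation of `F` at the
word formed by `m` independent uniform letters. -/
noncomputable def wordMean (m : ℕ) (F : List α → ℝ) : ℝ := 𝔼 x : Fin m → α, F (List.ofFn x)

lemma wordMean_mono {m : ℕ} {F G : List α → ℝ} (h : ∀ w, w.length = m → F w ≤ G w) :
    wordMean m F ≤ wordMean m G :=
  Finset.expect_le_expect fun _ _ => h _ (List.length_ofFn)

lemma wordMean_const_mul (m : ℕ) (a : ℝ) (F : List α → ℝ) :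
    wordMean m (fun w => a * F w) = a * wordMean m F :=
  (Finset.mul_expect ..).symm

lemma wordMean_add (m : ℕ) (F G : List α → ℝ) :
    wordMean m (fun w => F w + G w) = wordMean m F + wordMean m G :=
  Finset.expect_add_distrib ..

lemma wordMean_const [Nonempty α] (m : ℕ) (a : ℝ) : wordMean m (fun _ : List α => a) = a :=
  Fintype.expect_const a

lemma wordMean_zero (F : List α → ℝ) : wordMean 0 F = F [] := by
  simp [wordMean]

lemma wordMean_append (m₁ m₂ : ℕ) (F : List α → ℝ) :
    wordMean (m₁ + m₂) F = wordMean m₁ fun u => wordMean m₂ fun w => F (u ++ w) := by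
  simp only [wordMean, ← List.ofFn_fin_append]
  rw [← Finset.expect_product', Finset.univ_product_univ]
  exact (Fintype.expect_equiv (Fin.appendEquiv m₁ m₂) _ _ fun _ => rfl).symm

lemma wordMean_one (F : List α → ℝ) : wordMean 1 F = 𝔼 a, F [a] :=
  Fintype.expect_equiv (Equiv.funUnique (Fin 1) α) _ _ fun x => by simp

lemma wordMean_succ (m : ℕ) (F : List α → ℝ) :
    wordMean (m + 1) F = 𝔼 a, wordMean m fun w => F (a :: w) := by
  rw [add_comm, wordMean_append, wordMean_one]
  rfl

variable {σ : Type*} {step : σ → α → σ}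

lemma wordMean_exp_additive_le {Y : σ → List α → ℝ} {y : σ → α → ℝ} {r : ℝ}
    (hnil : ∀ s, Y s [] = 0) (hcons : ∀ s a w, Y s (a :: w) = y s a + Y (step s a) w)
    (hy : ∀ s, 𝔼 a, Real.exp (y s a) ≤ Real.exp r) (m : ℕ) (s : σ) :
    wordMean m (fun w => Real.exp (Y s w)) ≤ Real.exp (m * r) := by
  induction m generalizing s with
  | zero => simp [wordMean_zero, hnil]
  | succ m ih =>
    simp only [wordMean_succ, hcons, Real.exp_add, wordMean_const_mul]
    calc 𝔼 a, Real.exp (y s a) * wordMean m (fun w => Real.exp (Y (step s a) w))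
        ≤ 𝔼 a, Real.exp (y s a) * Real.exp (m * r) := by gcongr; exact ih _
      _ = (𝔼 a, Real.exp (y s a)) * Real.exp (m * r) := (Finset.expect_mul ..).symm
      _ ≤ Real.exp r * Real.exp (m * r) := by gcongr; exact hy s
      _ = Real.exp ((m + 1 : ℕ) * r) := by
        rw [← Real.exp_add]
        push_cast
        ring_nf

lemma wordMean_exp_countP_le [Nonempty α] (p : α → Prop) [DecidablePred p] (m : ℕ) :
    wordMean m (fun w : List α => Real.exp (w.countP p))
      ≤ Real.exp (m * (2 * Fintype.card {a // p a} / Fintype.card α)) := by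
  have expect_letter_le : 𝔼 a, Real.exp (if p a then (1 : ℝ) else 0)
      ≤ Real.exp (2 * Fintype.card {a // p a} / Fintype.card α) := by
    have exp_le (a : α) : Real.exp (if p a then 1 else 0) ≤ (if p a then (2 : ℝ) else 0) + 1 := by
      split
      · linarith [Real.exp_one_lt_d9]
      · simp
    calc 𝔼 a, Real.exp (if p a then 1 else 0)
        ≤ 𝔼 a, ((if p a then (2 : ℝ) else 0) + 1) := Finset.expect_le_expect fun a _ => exp_le a
      _ = 2 * Fintype.card {a // p a} / Fintype.card α + 1 := by
        rw [Finset.expect_add_distrib, Fintype.expect_const, Fintype.expect_eq_sum_div_card,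
          ← Finset.sum_filter, Finset.sum_const, Fintype.card_subtype, nsmul_eq_mul, mul_comm]
      _ ≤ Real.exp (2 * Fintype.card {a // p a} / Fintype.card α) := Real.add_one_le_exp _
  have cons (a : α) (w : List α) :
      ((a :: w).countP p : ℝ) = (if p a then (1 : ℝ) else 0) + w.countP p := by
    by_cases h : p a <;> simp [h, add_comm]
  exact (wordMean_exp_additive_le (Y := fun (_ : Unit) w => (w.countP p : ℝ))
    (y := fun _ a => if p a then (1 : ℝ) else 0) (step := fun _ _ => ()) (fun _ => by simp)
    (fun _ => cons) (fun _ => expect_letter_le) m () :)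

lemma wordMean_foldl_mul_le [Nonempty α] {f : σ → ℝ} {ρ K : ℝ} (hρ₀ : 0 ≤ ρ) (hρ₁ : ρ < 1)
    (hK : 0 ≤ K) {m : ℕ} (hf : ∀ s, wordMean m (fun w => f (w.foldl step s)) ≤ ρ * f s + K)
    (j : ℕ) (s : σ) :
    wordMean (j * m) (fun w => f (w.foldl step s)) ≤ ρ ^ j * f s + K / (1 - ρ) := by
  have hρ : 0 < 1 - ρ := sub_pos.mpr hρ₁
  induction j with
  | zero =>
    simp only [zero_mul, wordMean_zero, List.foldl_nil, pow_zero, one_mul]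
    exact le_add_of_nonneg_right (by positivity)
  | succ j ih =>
    simp only [add_one_mul, wordMean_append, List.foldl_append]
    calc wordMean (j * m) (fun u => wordMean m fun w => f (w.foldl step (u.foldl step s)))
        ≤ wordMean (j * m) (fun u => ρ * f (u.foldl step s) + K) :=
          wordMean_mono fun _ _ => hf _
      _ = ρ * wordMean (j * m) (fun u => f (u.foldl step s)) + K := by
          rw [wordMean_add, wordMean_const, wordMean_const_mul]
      _ ≤ ρ * (ρ ^ j * f s + K / (1 - ρ)) + K := by gcongr
      _ = ρ ^ (j + 1) * f s + K / (1 - ρ) := by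
          field_simp
          ring

end WordMean

lemma expect_exp_le {ι : Type*} [Fintype ι] [Nonempty ι] {y : ι → ℝ} {b r : ℝ} (hb : b ≤ 1)
    (hy : ∀ i, |y i| ≤ b) (hr : 𝔼 i, y i ≤ r) : 𝔼 i, Real.exp (y i) ≤ Real.exp (r + b ^ 2) := by
  have exp_le (i : ι) : Real.exp (y i) ≤ y i + (b ^ 2 + 1) := by
    have h := (abs_le.mp (Real.abs_exp_sub_one_sub_id_le ((hy i).trans hb))).2
    have : y i ^ 2 ≤ b ^ 2 := sq_le_sq' (abs_le.mp (hy i)).1 (abs_le.mp (hy i)).2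
    linarith
  calc 𝔼 i, Real.exp (y i) ≤ 𝔼 i, (y i + (b ^ 2 + 1)) :=
        Finset.expect_le_expect fun i _ => exp_le i
    _ = 𝔼 i, y i + (b ^ 2 + 1) := by rw [Finset.expect_add_distrib, Fintype.expect_const]
    _ ≤ (r + b ^ 2) + 1 := by linarith
    _ ≤ Real.exp (r + b ^ 2) := Real.add_one_le_exp _

section RandomEvolver

variable {V Ω : Type*} [MeasurableSpace Ω] {T : SimpleGraph V} [Fintype T.edgeSet]
  {μ : Measure Ω} {E : ℕ → Ω → T.edgeSet}

lemma IsRandomEvolver.measureReal_setOf_eq (hE : IsRandomEvolver T μ E) {m : ℕ}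
    (x : Fin m → T.edgeSet) :
    μ.real {ω | (fun i : Fin m => E i ω) = x} = (Fintype.card T.edgeSet ^ m : ℝ)⁻¹ := by
  have heq : {ω | (fun i : Fin m => E i ω) = x} = ⋂ i ∈ Finset.univ, E (i : Fin m) ⁻¹' {x i} := by
    ext ω
    simp [funext_iff]
  have hind := (hE.indep.precomp Fin.val_injective).measure_inter_preimage_eq_mul
    (Finset.univ : Finset (Fin m)) (sets := fun i => {x i})
    fun _ _ => MeasurableSpace.measurableSet_top
  have huni (i : Fin m) : μ (E i ⁻¹' {x i}) = (Nat.card T.edgeSet : ENNReal)⁻¹ := hE.uniform i _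
  rw [heq, measureReal_def, hind]
  simp [huni, Nat.card_eq_fintype_card]

lemma IsRandomEvolver.measureReal_le_wordMean (hE : IsRandomEvolver T μ E) {m : ℕ}
    {F : List T.edgeSet → ℝ} (hF : ∀ w, 0 ≤ F w) {S : Set Ω}
    (hS : ∀ ω ∈ S, 1 ≤ F (List.ofFn fun i : Fin m => E i ω)) :
    μ.real S ≤ wordMean m F := by
  classical
  have := hE.indep.isProbabilityMeasure
  set X : Finset (Fin m → T.edgeSet) := {x | 1 ≤ F (List.ofFn x)} with hX
  calc μ.real S ≤ μ.real (⋃ x ∈ X, {ω | (fun i : Fin m => E i ω) = x}) := by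
        refine measureReal_mono (fun ω hω => ?_) (measure_ne_top _ _)
        simpa [hX] using hS ω hω
    _ ≤ ∑ x ∈ X, μ.real {ω | (fun i : Fin m => E i ω) = x} := measureReal_biUnion_finset_le _ _
    _ = ∑ _ ∈ X, (Fintype.card T.edgeSet ^ m : ℝ)⁻¹ := by simp only [hE.measureReal_setOf_eq]
    _ ≤ ∑ x ∈ X, (Fintype.card T.edgeSet ^ m : ℝ)⁻¹ * F (List.ofFn x) :=
        Finset.sum_le_sum fun _ hx =>
          le_mul_of_one_le_right (by positivity) (Finset.mem_filter.mp hx).2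
    _ ≤ ∑ x, (Fintype.card T.edgeSet ^ m : ℝ)⁻¹ * F (List.ofFn x) :=
        Finset.sum_le_sum_of_subset_of_nonneg (Finset.subset_univ _)
          fun _ _ _ => mul_nonneg (by positivity) (hF _)
    _ = wordMean m F := by
        rw [wordMean, Fintype.expect_eq_sum_div_card, ← Finset.mul_sum, ← div_eq_inv_mul]
        simp

end RandomEvolver

section Distance

variable {V : Type*} {G : SimpleGraph V}

lemma dist_snd_add_one {u w : V} (h : u ≠ w) {p : G.Walk u w}
    (hp : p.length = G.dist u w) : G.dist p.snd w + 1 = G.dist u w := by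
  have hnil : ¬p.Nil := SimpleGraph.Walk.not_nil_of_ne h
  have length_tail : p.tail.length + 1 = p.length := SimpleGraph.Walk.length_tail_add_one hnil
  have tail_shortest : p.tail.length = G.dist p.snd w :=
    SimpleGraph.length_eq_dist_of_subwalk hp p.isSubwalk_rfl.tail
  omega

lemma abs_dist_sub_dist_le_one (u : V) {a b : V} (hab : G.Adj a b) :
    |(G.dist u b : ℝ) - G.dist u a| ≤ 1 := by
  have hd := hab.diff_dist_adj (u := u)
  have hle : G.dist u b ≤ G.dist u a + 1 := by omega
  have hge : G.dist u a ≤ G.dist u b + 1 := by omega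
  rify at hle hge
  exact abs_le.mpr ⟨by linarith, by linarith⟩

end Distance

section Algorithm

variable {n : ℕ} {V : Type*} [DecidableEq V] {T : SimpleGraph V}

/-- The number of null answers (`0` or `1`) that the next query of the algorithm gets. -/
def nullCount (s : State n V) : ℕ :=
  if s.hypLoc s.current = s.trueLoc s.current then 1 else 0

/-- The number of null answers that the next `j` queries get while the evolver is at rest. -/
noncomputable def nullsDuring (hT : T.IsTree) (s : State n V) (j : ℕ) : ℕ :=
  ∑ i ∈ Finset.range j, nullCount ((algStep hT)^[i] s)

/-- The total distance of the hypothesized from the true locations. -/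
noncomputable def totalDist (T : SimpleGraph V) (s : State n V) : ℕ :=
  ∑ l, T.dist (s.hypLoc l) (s.trueLoc l)

/-- The number of labels whose hypothesized location is wrong. -/
def wrongCount (s : State n V) : ℕ := ∑ l, if s.hypLoc l = s.trueLoc l then 0 else 1

variable (hT : T.IsTree) (s : State n V)

lemma nullCount_le_one : nullCount s ≤ 1 := by
  unfold nullCount
  split <;> simp

lemma exists_oracleTo_eq_some {u w : V} (h : u ≠ w) :
    ∃ v, oracleTo hT w u = some v ∧ T.dist v w + 1 = T.dist u w := by
  obtain ⟨p, hp, hlen⟩ := hT.connected.exists_path_of_dist u w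
  have hpath := (hT.existsUnique_path u w).choose_spec
  exact ⟨_, if_neg h, dist_snd_add_one h (hpath.2 p hp ▸ hlen)⟩

variable {s} in
lemma algStep_of_eq (h : s.hypLoc s.current = s.trueLoc s.current) :
    algStep hT s = { s with current := finRotate n s.current } := by
  simp [algStep, oracle, oracleTo, h]

variable {s} in
lemma exists_algStep_of_ne (h : s.hypLoc s.current ≠ s.trueLoc s.current) :
    ∃ v, T.dist v (s.trueLoc s.current) + 1 = T.dist (s.hypLoc s.current) (s.trueLoc s.current) ∧
      algStep hT s = { s with hypLoc := Function.update s.hypLoc s.current v } := by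
  obtain ⟨v, hv, hd⟩ := exists_oracleTo_eq_some hT h
  exact ⟨v, hd, by simp only [algStep, oracle, hv]⟩

lemma trueLoc_algStep : (algStep hT s).trueLoc = s.trueLoc := by
  by_cases h : s.hypLoc s.current = s.trueLoc s.current
  · rw [algStep_of_eq hT h]
  · obtain ⟨v, -, hs⟩ := exists_algStep_of_ne hT h
    rw [hs]

variable {s} in
lemma hypLoc_algStep_of_ne_current {l : Fin n} (hl : l ≠ s.current) :
    (algStep hT s).hypLoc l = s.hypLoc l := by
  by_cases h : s.hypLoc s.current = s.trueLoc s.current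
  · rw [algStep_of_eq hT h]
  · obtain ⟨v, -, hs⟩ := exists_algStep_of_ne hT h
    rw [hs]
    exact Function.update_of_ne hl _ _

lemma current_algStep : (algStep hT s).current = (finRotate n)^[nullCount s] s.current := by
  by_cases h : s.hypLoc s.current = s.trueLoc s.current
  · simp [algStep_of_eq hT h, nullCount, h]
  · obtain ⟨v, -, hs⟩ := exists_algStep_of_ne hT h
    simp [hs, nullCount, h]

lemma dist_algStep_current_add_one :
    T.dist ((algStep hT s).hypLoc s.current) (s.trueLoc s.current) + 1
      = T.dist (s.hypLoc s.current) (s.trueLoc s.current) + nullCount s := by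
  by_cases h : s.hypLoc s.current = s.trueLoc s.current
  · simp [algStep_of_eq hT h, nullCount, h]
  · obtain ⟨v, hv, hs⟩ := exists_algStep_of_ne hT h
    simp [hs, nullCount, h, hv]

lemma dist_algStep_le (l : Fin n) :
    T.dist ((algStep hT s).hypLoc l) (s.trueLoc l) ≤ T.dist (s.hypLoc l) (s.trueLoc l) := by
  by_cases hl : l = s.current
  · subst hl
    have := dist_algStep_current_add_one hT s
    have := nullCount_le_one s
    omega
  · rw [hypLoc_algStep_of_ne_current hT hl]

lemma sum_algStep_add (g : V → V → ℕ) :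
    ∑ l, g ((algStep hT s).hypLoc l) (s.trueLoc l) + g (s.hypLoc s.current) (s.trueLoc s.current)
      = ∑ l, g (s.hypLoc l) (s.trueLoc l)
        + g ((algStep hT s).hypLoc s.current) (s.trueLoc s.current) := by
  have rest : ∑ l ∈ Finset.univ.erase s.current, g ((algStep hT s).hypLoc l) (s.trueLoc l)
      = ∑ l ∈ Finset.univ.erase s.current, g (s.hypLoc l) (s.trueLoc l) :=
    Finset.sum_congr rfl fun l hl => by
      rw [hypLoc_algStep_of_ne_current hT (Finset.ne_of_mem_erase hl)]
  rw [← Finset.sum_erase_add _ _ (Finset.mem_univ s.current), rest,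
    ← Finset.sum_erase_add _ (fun l => g (s.hypLoc l) (s.trueLoc l)) (Finset.mem_univ s.current)]
  ring

lemma totalDist_algStep : totalDist T (algStep hT s) + 1 = totalDist T s + nullCount s := by
  have hsum := sum_algStep_add hT s T.dist
  have hcur := dist_algStep_current_add_one hT s
  rw [totalDist, totalDist, trueLoc_algStep]
  omega

/-- A correction of the current label is followed by a null answer for it. -/
lemma wrongCount_le_algStep :
    wrongCount s ≤ wrongCount (algStep hT s) + nullCount (algStep hT s) := by
  have hsum := sum_algStep_add hT s fun u w => if u = w then 0 else 1
  rw [wrongCount, wrongCount, trueLoc_algStep]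
  by_cases h : s.hypLoc s.current = s.trueLoc s.current
  · simp only [algStep_of_eq hT h]
    exact Nat.le_add_right _ _
  · obtain ⟨v, -, hs⟩ := exists_algStep_of_ne hT h
    have hcur : (algStep hT s).current = s.current := by rw [hs]
    rw [nullCount, hcur, trueLoc_algStep]
    rw [if_neg h] at hsum
    split_ifs at hsum ⊢ <;> omega

variable (j : ℕ)

lemma nullsDuring_succ :
    nullsDuring hT s (j + 1) = nullsDuring hT s j + nullCount ((algStep hT)^[j] s) :=
  Finset.sum_range_succ _ _

lemma totalDist_iterate_algStep :
    totalDist T ((algStep hT)^[j] s) + j = totalDist T s + nullsDuring hT s j := by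
  induction j with
  | zero => simp [nullsDuring]
  | succ j ih =>
    rw [Function.iterate_succ_apply', nullsDuring_succ]
    have := totalDist_algStep hT ((algStep hT)^[j] s)
    omega

lemma wrongCount_le_iterate_algStep :
    wrongCount s ≤ wrongCount ((algStep hT)^[j] s) + nullsDuring hT s j + 1 := by
  suffices wrongCount s + nullCount s
      ≤ wrongCount ((algStep hT)^[j] s) + nullsDuring hT s (j + 1) by
    have := nullCount_le_one ((algStep hT)^[j] s)
    rw [nullsDuring_succ] at *
    omega
  induction j with
  | zero => simp [nullsDuring]
  | succ j ih =>
    rw [nullsDuring_succ, Function.iterate_succ_apply']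
    have := wrongCount_le_algStep hT ((algStep hT)^[j] s)
    omega

end Algorithm

section Evolver

variable {n : ℕ} {V : Type*} [DecidableEq V] {T : SimpleGraph V}

lemma swapEnds_apply_of_notMem {e : Sym2 V} {v : V} (h : v ∉ e) : swapEnds e v = v := by
  induction e with
  | _ a b =>
    rw [Sym2.mem_iff, not_or] at h
    exact Equiv.swap_apply_of_ne_of_ne h.1 h.2

lemma adj_swapEnds_apply_of_mem {e : Sym2 V} (he : e ∈ T.edgeSet) {v : V} (h : v ∈ e) :
    T.Adj v (swapEnds e v) := by
  obtain ⟨w, rfl⟩ := Sym2.mem_iff_exists.mp h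
  rwa [show swapEnds s(v, w) v = w from Equiv.swap_apply_left v w]

lemma sum_edgeSet_swapEnds_sub [Fintype V] [DecidableRel T.Adj] (g : V → ℝ) (v : V) :
    ∑ e : T.edgeSet, (g (swapEnds (e : Sym2 V) v) - g v)
      = ∑ w ∈ T.neighborFinset v, (g w - g v) := by
  rw [← Finset.sum_subtype T.edgeFinset (p := (· ∈ T.edgeSet)) (by simp)
    (fun e => g (swapEnds e v) - g v)]
  symm
  refine Finset.sum_of_injOn (fun w => s(v, w)) (fun w _ w' _ h => Sym2.congr_right.mp h)
    (fun w hw => by simpa using hw) (fun e he hne => ?_) (fun w _ => ?_)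
  · rw [swapEnds_apply_of_notMem, sub_self]
    intro hv
    obtain ⟨w, rfl⟩ := Sym2.mem_iff_exists.mp hv
    exact hne ⟨w, by simpa using he, rfl⟩
  · rw [show swapEnds s(v, w) v = w from Equiv.swap_apply_left v w]

variable (s : State n V)

lemma abs_sum_evolverStep_sub_le (A : Finset (Fin n)) {f : Fin n → V → ℝ} {b : ℝ}
    (hf : ∀ l v w, T.Adj v w → |f l w - f l v| ≤ b) (e : T.edgeSet) :
    |∑ l ∈ A, f l ((evolverStep (e : Sym2 V) s).trueLoc l) - ∑ l ∈ A, f l (s.trueLoc l)|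
      ≤ 2 * b := by
  obtain ⟨e, he⟩ := e
  set moved : Finset (Fin n) := {l ∈ A | s.trueLoc l ∈ e}
  have card_moved : moved.card ≤ 2 := by
    refine (Finset.card_le_card_of_injOn s.trueLoc (t := e.toFinset) (fun l hl => ?_)
      s.trueLoc.injective.injOn).trans
        (e.card_toFinset_of_not_isDiag (T.not_isDiag_of_mem_edgeSet he)).le
    simpa using (Finset.mem_filter.mp hl).2
  have b_nonneg : 0 ≤ b := by
    obtain ⟨v, hv⟩ : ∃ v, v ∈ e := ⟨_, e.out_fst_mem⟩
    exact (abs_nonneg _).trans (hf (s.trueLoc.symm v) _ _ (adj_swapEnds_apply_of_mem he hv))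
  calc |∑ l ∈ A, f l ((evolverStep e s).trueLoc l) - ∑ l ∈ A, f l (s.trueLoc l)|
      = |∑ l ∈ A, (f l (swapEnds e (s.trueLoc l)) - f l (s.trueLoc l))| := by
        rw [Finset.sum_sub_distrib]
        rfl
    _ = |∑ l ∈ moved, (f l (swapEnds e (s.trueLoc l)) - f l (s.trueLoc l))| := by
        congr 1
        refine (Finset.sum_filter_of_ne fun l _ hne => ?_).symm
        by_contra hl
        exact hne (by rw [swapEnds_apply_of_notMem hl, sub_self])
    _ ≤ ∑ l ∈ moved, |f l (swapEnds e (s.trueLoc l)) - f l (s.trueLoc l)| :=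
        Finset.abs_sum_le_sum_abs _ _
    _ ≤ moved.card • b := Finset.sum_le_card_nsmul _ _ _ fun l hl =>
        hf l _ _ (adj_swapEnds_apply_of_mem he (Finset.mem_filter.mp hl).2)
    _ ≤ 2 * b := by
        rw [nsmul_eq_mul]
        gcongr
        exact_mod_cast card_moved

lemma sum_dist_evolverStep_le (A : Finset (Fin n)) (e : T.edgeSet) :
    ∑ l ∈ A, T.dist (s.hypLoc l) ((evolverStep (e : Sym2 V) s).trueLoc l)
      ≤ ∑ l ∈ A, T.dist (s.hypLoc l) (s.trueLoc l) + 2 := by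
  have h := (abs_le.mp (abs_sum_evolverStep_sub_le s A
    (fun l _ _ => abs_dist_sub_dist_le_one (s.hypLoc l)) e)).2
  rify
  linarith

end Evolver

section Potential

variable {n : ℕ} {V : Type*} [DecidableEq V] {T : SimpleGraph V} {β : ℝ}

/-- The contribution to the potential of a label hypothesized at `u` and truly at `w`: their
distance, with a bonus of `β` for being wrong. -/
noncomputable def labelPotential (T : SimpleGraph V) (β : ℝ) (u w : V) : ℝ :=
  T.dist u w - β * if u = w then 0 else 1

/-- The potential whose drift is controlled by the algorithm and the evolver together: the total
distance, minus `β` times the number of wrong labels. -/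
noncomputable def potential (T : SimpleGraph V) (β : ℝ) (s : State n V) : ℝ :=
  ∑ l, labelPotential T β (s.hypLoc l) (s.trueLoc l)

lemma potential_eq (s : State n V) : potential T β s = totalDist T s - β * wrongCount s := by
  simp only [potential, labelPotential, totalDist, wrongCount, Finset.sum_sub_distrib,
    ← Finset.mul_sum]
  push_cast
  rfl

lemma potential_le_totalDist (hβ : 0 ≤ β) (s : State n V) : potential T β s ≤ totalDist T s := by
  rw [potential_eq]
  exact sub_le_self _ (by positivity)

lemma neg_natCast_le_potential (hβ : β ≤ 1) (s : State n V) : -(n : ℝ) ≤ potential T β s := by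
  have label_ge (l : Fin n) : -1 ≤ labelPotential T β (s.hypLoc l) (s.trueLoc l) := by
    have : (0 : ℝ) ≤ T.dist (s.hypLoc l) (s.trueLoc l) := Nat.cast_nonneg _
    unfold labelPotential
    split_ifs <;> linarith
  simpa [potential] using Finset.sum_le_sum fun l (_ : l ∈ Finset.univ) => label_ge l

lemma abs_labelPotential_sub_le (hβ₀ : 0 ≤ β) (hβ₁ : β ≤ 1) (u : V) {v w : V} (h : T.Adj v w) :
    |labelPotential T β u w - labelPotential T β u v| ≤ 1 := by
  have hdist := abs_dist_sub_dist_le_one u h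
  unfold labelPotential
  by_cases hv : u = v
  · rw [← hv] at h ⊢
    rw [SimpleGraph.dist_self, SimpleGraph.dist_eq_one_iff_adj.mpr h, if_pos rfl, if_neg h.ne,
      abs_le]
    constructor <;> norm_num <;> linarith
  by_cases hw : u = w
  · rw [← hw] at h ⊢
    rw [SimpleGraph.dist_self, SimpleGraph.dist_eq_one_iff_adj.mpr h.symm, if_pos rfl,
      if_neg h.ne', abs_le]
    constructor <;> norm_num <;> linarith
  · simpa [hv, hw] using hdist

lemma abs_potential_evolverStep_sub_le (hβ₀ : 0 ≤ β) (hβ₁ : β ≤ 1) (s : State n V)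
    (e : T.edgeSet) : |potential T β (evolverStep (e : Sym2 V) s) - potential T β s| ≤ 2 :=
  (abs_sum_evolverStep_sub_le s Finset.univ
    (fun l _ _ => abs_labelPotential_sub_le hβ₀ hβ₁ (s.hypLoc l)) e).trans_eq (mul_one 2)

lemma potential_iterate_algStep_le (hβ₀ : 0 ≤ β) (hβ₁ : β ≤ 1) (hT : T.IsTree) (s : State n V)
    (j : ℕ) :
    potential T β ((algStep hT)^[j] s) ≤ potential T β s - j + 2 * nullsDuring hT s j + β := by
  have htotal := totalDist_iterate_algStep hT s j
  have hwrong := wrongCount_le_iterate_algStep hT s j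
  rify at htotal hwrong
  have hβwrong := mul_le_mul_of_nonneg_left hwrong hβ₀
  have hβnulls : β * nullsDuring hT s j ≤ nullsDuring hT s j :=
    mul_le_of_le_one_left (Nat.cast_nonneg _) hβ₁
  rw [potential_eq, potential_eq]
  linarith

variable [Fintype V] [DecidableRel T.Adj]

/-- One neighbor of a wrong true location is closer to the hypothesized one, which makes up for
the bonus `β` earned at all neighbors of a correct one. -/
lemma sum_neighborFinset_labelPotential_sub_le (hT : T.Connected) (hβ : 0 ≤ β) (u v : V)
    (hdeg : β * (T.degree v + 1) ≤ 2) :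
    ∑ w ∈ T.neighborFinset v, (labelPotential T β u w - labelPotential T β u v)
      ≤ (1 - β) * T.degree v := by
  by_cases huv : u = v
  · rw [← T.card_neighborFinset_eq_degree, mul_comm, ← nsmul_eq_mul]
    refine Finset.sum_le_card_nsmul _ _ _ fun w hw => le_of_eq ?_
    have hadj : T.Adj u w := huv ▸ (T.mem_neighborFinset v w).mp hw
    simp [labelPotential, ← huv, SimpleGraph.dist_eq_one_iff_adj.mpr hadj, hadj.ne]
  · obtain ⟨p, hp⟩ := hT.exists_walk_length_eq_dist v u
    have hadj : T.Adj v p.snd := p.adj_snd (SimpleGraph.Walk.not_nil_of_ne (Ne.symm huv))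
    have closer : labelPotential T β u p.snd - labelPotential T β u v ≤ -1 + β := by
      have hdist := dist_snd_add_one (Ne.symm huv) hp
      rify [T.dist_comm (v := u)] at hdist
      simp only [labelPotential, if_neg huv]
      split_ifs <;> linarith
    have degree_pos : (1 : ℝ) ≤ T.degree v :=
      mod_cast (T.degree_pos_iff_exists_adj v).mpr ⟨p.snd, hadj⟩
    have hβ₁ : β ≤ 1 := by nlinarith
    have hmem : p.snd ∈ T.neighborFinset v := (T.mem_neighborFinset v _).mpr hadj
    have others : ∑ w ∈ (T.neighborFinset v).erase p.snd,
        (labelPotential T β u w - labelPotential T β u v)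
        ≤ ((T.neighborFinset v).erase p.snd).card • (1 : ℝ) :=
      Finset.sum_le_card_nsmul _ _ _ fun w hw => (le_abs_self _).trans <|
        abs_labelPotential_sub_le hβ hβ₁ u
          ((T.mem_neighborFinset v w).mp (Finset.mem_of_mem_erase hw))
    have card_others : (((T.neighborFinset v).erase p.snd).card : ℝ) + 1 = T.degree v := by
      rw [← T.card_neighborFinset_eq_degree]
      exact_mod_cast Finset.card_erase_add_one hmem
    rw [← Finset.add_sum_erase _ _ hmem]
    rw [nsmul_eq_mul] at others
    linarith

lemma expect_potential_evolverStep_sub_le [Nonempty T.edgeSet] (hT : T.Connected) (hβ : 0 ≤ β)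
    (hdeg : β * (T.maxDegree + 1) ≤ 2) (s : State n V) :
    𝔼 e : T.edgeSet, (potential T β (evolverStep (e : Sym2 V) s) - potential T β s)
      ≤ 2 - 2 * β := by
  rw [Fintype.expect_eq_sum_div_card, div_le_iff₀ (Nat.cast_pos.mpr Fintype.card_pos)]
  have label_le (l : Fin n) :
      ∑ e : T.edgeSet, (labelPotential T β (s.hypLoc l) (swapEnds (e : Sym2 V) (s.trueLoc l))
          - labelPotential T β (s.hypLoc l) (s.trueLoc l))
        ≤ (1 - β) * T.degree (s.trueLoc l) := by
    rw [sum_edgeSet_swapEnds_sub (labelPotential T β (s.hypLoc l))]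
    refine sum_neighborFinset_labelPotential_sub_le hT hβ _ _ (le_trans ?_ hdeg)
    gcongr
    exact T.degree_le_maxDegree _
  calc ∑ e : T.edgeSet, (potential T β (evolverStep (e : Sym2 V) s) - potential T β s)
      = ∑ l, ∑ e : T.edgeSet,
          (labelPotential T β (s.hypLoc l) (swapEnds (e : Sym2 V) (s.trueLoc l))
            - labelPotential T β (s.hypLoc l) (s.trueLoc l)) := by
        simp only [potential, ← Finset.sum_sub_distrib]
        exact Finset.sum_comm
    _ ≤ ∑ l, (1 - β) * (T.degree (s.trueLoc l) : ℝ) := Finset.sum_le_sum fun l _ => label_le l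
    _ = (1 - β) * (∑ v, T.degree v : ℕ) := by
        rw [← Finset.mul_sum, s.trueLoc.sum_comp (fun v => (T.degree v : ℝ)), Nat.cast_sum]
    _ = (2 - 2 * β) * Fintype.card T.edgeSet := by
        rw [T.sum_degrees_eq_twice_card_edges, SimpleGraph.edgeFinset_card]
        push_cast
        ring

end Potential

section Round

variable {n : ℕ} {V : Type*} [DecidableEq V] {T : SimpleGraph V} (hT : T.IsTree) (c : ℕ)

/-- `c` steps of the algorithm, followed by a swap along `e`. -/
noncomputable def round (s : State n V) (e : T.edgeSet) : State n V :=
  evolverStep (e : Sym2 V) ((algStep hT)^[c] s)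

/-- The configuration after the rounds whose swaps are the letters of a word. -/
noncomputable def runWord (s : State n V) (w : List T.edgeSet) : State n V :=
  w.foldl (round hT c) s

/-- The number of null answers during the rounds whose swaps are the letters of a word. -/
noncomputable def wordNulls : State n V → List T.edgeSet → ℕ
  | _, [] => 0
  | s, e :: w => nullsDuring hT s c + wordNulls (round hT c s e) w

variable {c} in
lemma run_mul_add {j : ℕ} (hj : j < c) (E : ℕ → T.edgeSet) (s : State n V) (m : ℕ) :
    run hT c E s (c * m + j) = (algStep hT)^[j] (run hT c E s (c * m)) := by
  induction j with
  | zero => rfl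
  | succ j ih =>
    have not_dvd : ¬c ∣ c * m + j + 1 := by
      rw [add_assoc, Nat.dvd_add_right (dvd_mul_right c m)]
      exact Nat.not_dvd_of_pos_of_lt j.succ_pos hj
    rw [← add_assoc, run, if_neg not_dvd, ih (Nat.lt_of_succ_lt hj),
      Function.iterate_succ_apply']

variable {c} in
lemma run_mul (hc : 0 < c) (E : ℕ → T.edgeSet) (s : State n V) (m : ℕ) :
    run hT c E s (c * m) = runWord hT c s (List.ofFn fun i : Fin m => E i) := by
  induction m with
  | zero => rfl
  | succ m ih =>
    have last_step : c * (m + 1) = c * m + (c - 1) + 1 := by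
      rw [mul_add_one]
      omega
    have hdiv : (c * m + (c - 1)) / c = m := by
      rw [Nat.mul_add_div hc, Nat.div_eq_of_lt (by omega), add_zero]
    rw [last_step, run, ← last_step, if_pos (dvd_mul_right c _), hdiv,
      run_mul_add hT (Nat.sub_one_lt hc.ne'), ih, ← Function.iterate_succ_apply' (algStep hT),
      Nat.succ_eq_add_one, Nat.sub_add_cancel hc, List.ofFn_succ_last, runWord, runWord,
      List.foldl_append]
    rfl

variable {c} in
lemma run_eq_iterate_runWord (hc : 0 < c) (E : ℕ → T.edgeSet) (s : State n V) (t : ℕ) :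
    run hT c E s t
      = (algStep hT)^[t % c] (runWord hT c s (List.ofFn fun i : Fin (t / c) => E i)) := by
  rw [← run_mul hT hc, ← run_mul_add hT (Nat.mod_lt t hc), Nat.div_add_mod]

lemma runWord_append (s : State n V) (u w : List T.edgeSet) :
    runWord hT c s (u ++ w) = runWord hT c (runWord hT c s u) w :=
  List.foldl_append

lemma runWord_induction {P : ℕ → List T.edgeSet → State n V → Prop}
    (query : ∀ N h s, P N h s → P (N + nullCount s) h (algStep hT s))
    (swap : ∀ N h s (e : T.edgeSet), P N h s → P N (h ++ [e]) (evolverStep (e : Sym2 V) s))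
    {s : State n V} (start : P 0 [] s) (w : List T.edgeSet) :
    P (wordNulls hT c s w) w (runWord hT c s w) := by
  have queries (N h s) (hP : P N h s) (j : ℕ) :
      P (N + nullsDuring hT s j) h ((algStep hT)^[j] s) := by
    induction j with
    | zero => exact hP
    | succ j ih =>
      rw [nullsDuring_succ, ← add_assoc, Function.iterate_succ_apply']
      exact query _ _ _ ih
  suffices ∀ N h s, P N h s → P (N + wordNulls hT c s w) (h ++ w) (runWord hT c s w) by
    simpa using this 0 [] s start
  induction w with
  | nil => simp [wordNulls, runWord]
  | cons e w ih =>
    intro N h s hP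
    have := ih _ _ _ (swap _ _ _ e (queries _ _ _ hP c))
    rwa [add_assoc, List.append_assoc] at this

end Round

section Drift

variable {n : ℕ} {V : Type*} [DecidableEq V] [Fintype V] {T : SimpleGraph V} [DecidableRel T.Adj]
  [Nonempty T.edgeSet] (hT : T.IsTree) {c : ℕ} {β : ℝ}

lemma expect_exp_potential_round_le (hc : 2 ≤ c) (hβ : 0 ≤ β)
    (hdeg : β * (T.maxDegree + 1) ≤ 1) (s : State n V) :
    𝔼 e : T.edgeSet, Real.exp (β / 8 *
        (potential T β (round hT c s e) - potential T β s - 2 * nullsDuring hT s c))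
      ≤ Real.exp (-(β ^ 2 / 16)) := by
  have hβ₁ : β ≤ 1 := (le_mul_of_one_le_right hβ (by simp)).trans hdeg
  set s' := (algStep hT)^[c] s with hs'
  have alg_drift : potential T β s' - potential T β s - 2 * nullsDuring hT s c ≤ β - 2 := by
    have hc' : (2 : ℝ) ≤ c := mod_cast hc
    linarith [potential_iterate_algStep_le hβ hβ₁ hT s c]
  have evolver_step (e : T.edgeSet) :
      |β / 8 * (potential T β (evolverStep (e : Sym2 V) s') - potential T β s')| ≤ β / 4 := by
    rw [abs_mul, abs_of_nonneg (by positivity)]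
    linarith [mul_le_mul_of_nonneg_left (abs_potential_evolverStep_sub_le hβ hβ₁ s' e)
      (by positivity : 0 ≤ β / 8)]
  have evolver_drift :
      𝔼 e : T.edgeSet, β / 8 * (potential T β (evolverStep (e : Sym2 V) s') - potential T β s')
        ≤ β / 8 * (2 - 2 * β) := by
    rw [← Finset.mul_expect]
    gcongr
    exact expect_potential_evolverStep_sub_le hT.connected hβ (by linarith) s'
  calc _ ≤ 𝔼 e : T.edgeSet, Real.exp (β / 8 * (β - 2)) * Real.exp (β / 8 *
          (potential T β (evolverStep (e : Sym2 V) s') - potential T β s')) := by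
        refine Finset.expect_le_expect fun e _ => ?_
        rw [← Real.exp_add, ← mul_add]
        gcongr
        rw [round, ← hs']
        linarith
    _ ≤ Real.exp (β / 8 * (β - 2)) * Real.exp (β / 8 * (2 - 2 * β) + (β / 4) ^ 2) := by
        rw [← Finset.mul_expect]
        gcongr
        exact expect_exp_le (by linarith) evolver_step evolver_drift
    _ = Real.exp (-(β ^ 2 / 16)) := by
        rw [← Real.exp_add]
        ring_nf

lemma wordMean_exp_potential_runWord_le (hc : 2 ≤ c) (hβ : 0 ≤ β)
    (hdeg : β * (T.maxDegree + 1) ≤ 1) (m : ℕ) (s : State n V) :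
    wordMean m (fun w => Real.exp (β / 8 *
        (potential T β (runWord hT c s w) - potential T β s - 2 * wordNulls hT c s w)))
      ≤ Real.exp (m * -(β ^ 2 / 16)) := by
  refine wordMean_exp_additive_le (step := round hT c) (Y := fun s w => β / 8 *
      (potential T β (runWord hT c s w) - potential T β s - 2 * wordNulls hT c s w))
    (fun s => ?_) (fun s e w => ?_) (expect_exp_potential_round_le hT hc hβ hdeg) m s
  · simp [runWord, wordNulls]
  · simp only [runWord, wordNulls, List.foldl_cons]
    push_cast
    ring

end Drift

section Window

variable {n : ℕ} {V : Type*} [DecidableEq V] {T : SimpleGraph V}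

/-- The first `N` labels in the cyclic order that starts with `l₀`: those that have been checked
after `N` null answers if `l₀` was current at the beginning. -/
def checkedLabels (l₀ : Fin n) (N : ℕ) : Finset (Fin n) :=
  (Finset.range N).image fun j => (finRotate n)^[j] l₀

lemma checkedLabels_succ (l₀ : Fin n) (N : ℕ) :
    checkedLabels l₀ (N + 1) = insert ((finRotate n)^[N] l₀) (checkedLabels l₀ N) := by
  rw [checkedLabels, Finset.range_add_one, Finset.image_insert, checkedLabels]

lemma checkedLabels_eq_univ (l₀ : Fin n) {N : ℕ} (h : n ≤ N) :
    checkedLabels l₀ N = Finset.univ := by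
  have := l₀.neZero
  refine Finset.eq_univ_of_forall fun l => Finset.mem_image.mpr
    ⟨(l - l₀ : Fin n), Finset.mem_range.mpr ((l - l₀).isLt.trans_le h), ?_⟩
  rw [← finCycle_eq_finRotate_iterate, finCycle_apply, add_sub_cancel]

variable (hT : T.IsTree)

lemma current_algStep_eq_iterate {l₀ : Fin n} {N : ℕ} {s : State n V}
    (h : s.current = (finRotate n)^[N] l₀) :
    (algStep hT s).current = (finRotate n)^[N + nullCount s] l₀ := by
  rw [current_algStep, h, add_comm, Function.iterate_add_apply]

lemma sum_dist_checkedLabels_algStep_le {l₀ : Fin n} {N : ℕ} {s : State n V}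
    (h : s.current = (finRotate n)^[N] l₀) :
    ∑ l ∈ checkedLabels l₀ (N + nullCount s),
        T.dist ((algStep hT s).hypLoc l) ((algStep hT s).trueLoc l)
      ≤ ∑ l ∈ checkedLabels l₀ N, T.dist (s.hypLoc l) (s.trueLoc l) := by
  rw [trueLoc_algStep]
  refine (Finset.sum_le_sum fun l _ => dist_algStep_le hT s l).trans ?_
  by_cases hs : s.hypLoc s.current = s.trueLoc s.current
  · rw [nullCount, if_pos hs, checkedLabels_succ, ← h]
    by_cases hmem : s.current ∈ checkedLabels l₀ N
    · rw [Finset.insert_eq_of_mem hmem]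
    · simp [Finset.sum_insert hmem, hs]
  · rw [nullCount, if_neg hs, add_zero]

variable (c : ℕ)

/-- A checked label was at distance `0` when it was checked; only the swaps can have increased the
distances since then. -/
lemma totalDist_runWord_le_of_le_wordNulls {s : State n V} {w : List T.edgeSet}
    (h : n ≤ wordNulls hT c s w) : totalDist T (runWord hT c s w) ≤ 2 * w.length := by
  have invariant := (runWord_induction hT c (s := s) (P := fun N h s' =>
      s'.current = (finRotate n)^[N] s.current ∧
        ∑ l ∈ checkedLabels s.current N, T.dist (s'.hypLoc l) (s'.trueLoc l) ≤ 2 * h.length)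
    (fun N h s' hP => ⟨current_algStep_eq_iterate hT hP.1,
      (sum_dist_checkedLabels_algStep_le hT hP.1).trans hP.2⟩)
    (fun N h s' e hP => ⟨hP.1, (sum_dist_evolverStep_le s' _ e).trans (by simp; omega)⟩)
    (by simp [checkedLabels]) w).2
  rwa [checkedLabels_eq_univ _ h] at invariant

/-- The number of swaps in a word that involve the vertex `v`. -/
def swapCount (v : V) (w : List T.edgeSet) : ℕ := w.countP fun e : T.edgeSet => v ∈ (e : Sym2 V)

/-- `A` holds the label truly at `v`, and among the first `N` labels in the cyclic order from `l₀`,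
all those hypothesized at `v`, except possibly the current one. -/
structure Covers (l₀ : Fin n) (v : V) (N : ℕ) (A : Finset (Fin n)) (s : State n V) : Prop where
  current_eq : s.current = (finRotate n)^[N] l₀
  true_mem : s.trueLoc.symm v ∈ A
  hyp_mem : ∀ l ∈ checkedLabels l₀ N, l ≠ s.current → s.hypLoc l = v → l ∈ A

namespace Covers

variable {l₀ : Fin n} {v : V} {N : ℕ} {A : Finset (Fin n)} {s : State n V}

lemma query (h : Covers l₀ v N A s) : Covers l₀ v (N + nullCount s) A (algStep hT s) := by
  refine ⟨current_algStep_eq_iterate hT h.current_eq,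
    by simpa only [trueLoc_algStep] using h.true_mem, ?_⟩
  by_cases hs : s.hypLoc s.current = s.trueLoc s.current
  · rw [nullCount, if_pos hs, checkedLabels_succ, ← h.current_eq, algStep_of_eq hT hs]
    rintro l hl - rfl
    by_cases hc : l = s.current
    · have := h.true_mem
      rwa [hc, hs, Equiv.symm_apply_apply, ← hc] at this
    · exact h.hyp_mem l (Finset.mem_of_mem_insert_of_ne hl hc) hc rfl
  · rw [nullCount, if_neg hs, add_zero]
    have hcur : (algStep hT s).current = s.current := by simp [current_algStep, nullCount, hs]
    rw [hcur]
    intro l hl hc hlv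
    rw [hypLoc_algStep_of_ne_current hT hc] at hlv
    exact h.hyp_mem l hl hc hlv

lemma exists_evolverStep (h : Covers l₀ v N A s) (e : Sym2 V) :
    ∃ A' : Finset (Fin n), A'.card ≤ A.card + (if v ∈ e then 1 else 0) ∧
      Covers l₀ v N A' (evolverStep e s) := by
  by_cases hv : v ∈ e
  · refine ⟨insert ((evolverStep e s).trueLoc.symm v) A, ?_, h.current_eq,
      Finset.mem_insert_self _ _, fun l hl hc hlv => Finset.mem_insert_of_mem
        (h.hyp_mem l hl hc hlv)⟩
    rw [if_pos hv]
    exact Finset.card_insert_le _ _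
  · refine ⟨A, Nat.le_add_right _ _, h.current_eq, ?_, h.hyp_mem⟩
    have : (swapEnds e).symm v = v :=
      (swapEnds e).symm_apply_eq.mpr (swapEnds_apply_of_notMem hv).symm
    simpa [evolverStep, this] using h.true_mem

end Covers

lemma exists_covers_runWord (s : State n V) (v : V) (w : List T.edgeSet) :
    ∃ A : Finset (Fin n), A.card ≤ 1 + swapCount v w ∧
      Covers s.current v (wordNulls hT c s w) A (runWord hT c s w) := by
  refine runWord_induction hT c (P := fun N h s' => ∃ A : Finset (Fin n),
    A.card ≤ 1 + swapCount v h ∧ Covers s.current v N A s') ?_ ?_ ?_ w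
  · rintro N h s' ⟨A, hA, hcov⟩
    exact ⟨A, hA, hcov.query hT⟩
  · rintro N h s' e ⟨A, hA, hcov⟩
    obtain ⟨A', hA', hcov'⟩ := hcov.exists_evolverStep e
    refine ⟨A', hA'.trans ?_, hcov'⟩
    simp only [swapCount, List.countP_append, List.countP_singleton, decide_eq_true_eq] at hA ⊢
    omega
  · exact ⟨{s.trueLoc.symm v}, by simp, rfl, by simp, by simp [checkedLabels]⟩

/-- The labels hypothesized at `v`, up to one, were truly at `v` at some time during the word. -/
lemma card_labelsAt_runWord_le_of_le_wordNulls {s : State n V} {w : List T.edgeSet}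
    (h : n ≤ wordNulls hT c s w) (v : V) :
    (labelsAt (runWord hT c s w) v).card ≤ 2 + swapCount v w := by
  obtain ⟨A, hA, hcov⟩ := exists_covers_runWord hT c s v w
  have hsub : labelsAt (runWord hT c s w) v ⊆ insert (runWord hT c s w).current A := by
    intro l hl
    rw [Finset.mem_insert, or_iff_not_imp_left]
    exact fun hc => hcov.hyp_mem l (by simp [checkedLabels_eq_univ _ h]) hc
      (Finset.mem_filter.mp hl).2
  have := (Finset.card_le_card hsub).trans (Finset.card_insert_le _ _)
  omega

lemma card_labelsAt_algStep_le (s : State n V) (v : V) :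
    (labelsAt (algStep hT s) v).card ≤ (labelsAt s v).card + 1 := by
  refine (Finset.card_le_card (t := insert s.current (labelsAt s v)) fun l hl => ?_).trans
    (Finset.card_insert_le _ _)
  rw [Finset.mem_insert, or_iff_not_imp_left]
  intro hc
  have := (Finset.mem_filter.mp hl).2
  rw [hypLoc_algStep_of_ne_current hT hc] at this
  exact Finset.mem_filter.mpr ⟨Finset.mem_univ l, this⟩

lemma card_labelsAt_iterate_algStep_le (s : State n V) (v : V) (j : ℕ) :
    (labelsAt ((algStep hT)^[j] s) v).card ≤ (labelsAt s v).card + j := by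
  induction j with
  | zero => rfl
  | succ j ih =>
    rw [Function.iterate_succ_apply']
    exact (card_labelsAt_algStep_le hT _ v).trans (by omega)

end Window

lemma totalDist_le_sq {n : ℕ} {V : Type*} {T : SimpleGraph V} (hT : T.Connected)
    (s : State n V) : totalDist T s ≤ n ^ 2 := by
  have : Fintype V := Fintype.ofEquiv _ s.trueLoc
  calc totalDist T s ≤ ∑ _l : Fin n, n := by
        refine Finset.sum_le_sum fun l _ => ?_
        obtain ⟨p, hp, hlen⟩ := hT.exists_path_of_dist (s.hypLoc l) (s.trueLoc l)
        have := hp.length_lt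
        rw [← Fintype.card_congr s.trueLoc, Fintype.card_fin] at this
        omega
    _ = n ^ 2 := by simp [sq]

lemma wordMean_exp_swapCount_le {V : Type*} [DecidableEq V] [Fintype V] {T : SimpleGraph V}
    [DecidableRel T.Adj] [Nonempty T.edgeSet] (v : V) (m : ℕ) :
    wordMean m (fun w : List T.edgeSet => Real.exp (swapCount v w))
      ≤ Real.exp (m * (2 * T.degree v / Fintype.card T.edgeSet)) := by
  have card_incident : Fintype.card {e : T.edgeSet // v ∈ (e : Sym2 V)} = T.degree v := by
    rw [Fintype.card_subtype, ← T.card_incidenceFinset_eq_degree, T.incidenceFinset_eq_filter,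
      Finset.card_filter, Finset.card_filter,
      Finset.sum_subtype T.edgeFinset (p := (· ∈ T.edgeSet)) (by simp)]
  rw [← card_incident]
  exact wordMean_exp_countP_le (fun e : T.edgeSet => v ∈ (e : Sym2 V)) m

lemma card_labelsAt_run_le {n : ℕ} {V : Type*} [DecidableEq V] {T : SimpleGraph V} (hT : T.IsTree)
    {c : ℕ} (hc : 0 < c) (E : ℕ → T.edgeSet) (s : State n V) (t : ℕ) {u w : List T.edgeSet}
    (huw : List.ofFn (fun i : Fin (t / c) => E i) = u ++ w)
    (h : n ≤ wordNulls hT c (runWord hT c s u) w) (v : V) :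
    (labelsAt (run hT c E s t) v).card ≤ c + 2 + swapCount v w := by
  rw [run_eq_iterate_runWord hT hc, huw, runWord_append]
  have hiter := card_labelsAt_iterate_algStep_le hT (runWord hT c (runWord hT c s u) w) v (t % c)
  have hword := card_labelsAt_runWord_le_of_le_wordNulls hT c h v
  have := Nat.mod_lt t hc
  omega

lemma le_two_mul_card_edgeSet {n : ℕ} {V : Type*} {T : SimpleGraph V} [Fintype T.edgeSet]
    [Nonempty T.edgeSet] (hT : T.IsTree) (s : State n V) : n ≤ 2 * Fintype.card T.edgeSet := by
  have := Fintype.ofEquiv _ s.trueLoc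
  have card_V : Fintype.card V = n := by simp [← Fintype.card_congr s.trueLoc]
  have card_edges := hT.card_edgeFinset
  have := Fintype.card_pos (α := T.edgeSet)
  rw [SimpleGraph.edgeFinset_card] at card_edges
  omega

lemma mul_two_mul_degree_div_card_edgeSet_le {n k : ℕ} {V : Type*} [Fintype V]
    {T : SimpleGraph V} [DecidableRel T.Adj] [Fintype T.edgeSet] [Nonempty T.edgeSet]
    (hT : T.IsTree) (hk : T.maxDegree ≤ k) (s : State n V) (v : V) (q : ℕ) :
    (q * n : ℕ) * (2 * T.degree v / Fintype.card T.edgeSet : ℝ) ≤ 4 * k * q := by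
  have hn := le_two_mul_card_edgeSet hT s
  have hdeg : T.degree v ≤ k := (T.degree_le_maxDegree v).trans hk
  rw [← mul_div_assoc, div_le_iff₀ (mod_cast Fintype.card_pos)]
  rify at hn hdeg
  push_cast
  calc (q * n * (2 * T.degree v) : ℝ)
      ≤ q * (2 * Fintype.card T.edgeSet) * (2 * k) := by gcongr
    _ = 4 * k * q * Fintype.card T.edgeSet := by ring

section Tail

variable {n : ℕ} {V : Type*} [DecidableEq V] [Fintype V] {T : SimpleGraph V} [DecidableRel T.Adj]
  [Nonempty T.edgeSet] (hT : T.IsTree) {c : ℕ} {β : ℝ}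

lemma wordMean_exp_potential_block_le (hc : 2 ≤ c) (hβ : 0 ≤ β)
    (hdeg : β * (T.maxDegree + 1) ≤ 1) {m : ℕ} (hm : 32 * n ≤ β ^ 2 * m) (s : State n V) :
    wordMean m (fun w => Real.exp (β / 8 * potential T β (runWord hT c s w)))
      ≤ Real.exp (-1) * Real.exp (β / 8 * potential T β s) + Real.exp (β / 4 * m) := by
  have hβ₁ : β ≤ 1 := (le_mul_of_one_le_right hβ (by simp)).trans hdeg
  have pointwise (w : List T.edgeSet) (hw : w.length = m) :
      Real.exp (β / 8 * potential T β (runWord hT c s w))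
        ≤ Real.exp (β / 8 * potential T β s + β / 4 * n) * Real.exp (β / 8 *
            (potential T β (runWord hT c s w) - potential T β s - 2 * wordNulls hT c s w))
          + Real.exp (β / 4 * m) := by
    rcases le_total n (wordNulls hT c s w) with hN | hN
    · refine le_add_of_nonneg_of_le (by positivity) (Real.exp_le_exp.mpr ?_)
      have htotal := totalDist_runWord_le_of_le_wordNulls hT c hN
      rw [hw] at htotal
      rify at htotal
      have := (potential_le_totalDist hβ (runWord hT c s w)).trans htotal
      linarith [mul_le_mul_of_nonneg_left this (by positivity : 0 ≤ β / 8)]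
    · refine le_add_of_le_of_nonneg ?_ (by positivity)
      rify at hN
      rw [← Real.exp_add, Real.exp_le_exp]
      linarith [mul_le_mul_of_nonneg_left hN hβ]
  calc _ ≤ Real.exp (β / 8 * potential T β s + β / 4 * n) * Real.exp (m * -(β ^ 2 / 16))
        + Real.exp (β / 4 * m) := by
        refine (wordMean_mono pointwise).trans ?_
        rw [wordMean_add, wordMean_const_mul, wordMean_const]
        gcongr
        exact wordMean_exp_potential_runWord_le hT hc hβ hdeg m s
    _ ≤ _ := by
        have hn' : (1 : ℝ) ≤ n := mod_cast s.current.pos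
        rw [← Real.exp_add, ← Real.exp_add]
        refine add_le_add_left (Real.exp_le_exp.mpr ?_) _
        linarith [mul_le_mul_of_nonneg_right hβ₁ (Nat.cast_nonneg (α := ℝ) n)]

lemma wordMean_exp_potential_le (hc : 2 ≤ c) (hβ : 0 ≤ β) (hdeg : β * (T.maxDegree + 1) ≤ 1)
    {m : ℕ} (hm : 32 * n ≤ β ^ 2 * m) {a : ℕ} (ha : n ^ 2 * m ≤ a)
    (s : State n V) :
    wordMean a (fun w => Real.exp (β / 8 * potential T β (runWord hT c s w)))
      ≤ 3 * Real.exp (β / 4 * m) := by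
  have hβ₁ : β ≤ 1 := (le_mul_of_one_le_right hβ (by simp)).trans hdeg
  have blocks (s' : State n V) := wordMean_foldl_mul_le (step := round hT c)
    (f := fun s => Real.exp (β / 8 * potential T β s)) (Real.exp_pos (-1)).le (by simp)
    (Real.exp_pos (β / 4 * m)).le
    (wordMean_exp_potential_block_le hT hc hβ hdeg hm) (n ^ 2) s'
  have initial_le (s' : State n V) :
      Real.exp (-1) ^ n ^ 2 * Real.exp (β / 8 * potential T β s') ≤ Real.exp (β / 4 * m) := by
    have htotal : (totalDist T s' : ℝ) ≤ (n ^ 2 : ℕ) :=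
      mod_cast totalDist_le_sq hT.connected s'
    rw [← Real.exp_nat_mul, ← Real.exp_add, Real.exp_le_exp]
    calc _ ≤ (n ^ 2 : ℕ) * -1 + β / 8 * (n ^ 2 : ℕ) := by
          gcongr
          exact (potential_le_totalDist hβ s').trans htotal
      _ ≤ 0 := by nlinarith [Nat.cast_nonneg (α := ℝ) (n ^ 2), hβ₁]
      _ ≤ β / 4 * m := by positivity
  have geometric_le : Real.exp (β / 4 * m) / (1 - Real.exp (-1)) ≤ 2 * Real.exp (β / 4 * m) := by
    have : Real.exp (-1) ≤ 1 / 2 := by linarith [Real.exp_neg_one_lt_d9]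
    rw [div_le_iff₀ (by linarith)]
    nlinarith [Real.exp_pos (β / 4 * m)]
  obtain ⟨a, rfl⟩ := Nat.exists_eq_add_of_le' ha
  simp only [wordMean_append, runWord_append]
  refine (wordMean_mono fun w _ => ?_).trans_eq (wordMean_const a _)
  exact (blocks _).trans (by linarith [initial_le (runWord hT c s w)])

lemma wordMean_wordNulls_lt_le (hc : 2 ≤ c) (hβ : 0 ≤ β) (hdeg : β * (T.maxDegree + 1) ≤ 1)
    (r : ℕ) (s : State n V) :
    wordMean r (fun w => if wordNulls hT c s w < n then (1 : ℝ) else 0)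
      ≤ Real.exp (3 / 8 * β * n - β ^ 2 / 16 * r) * Real.exp (β / 8 * potential T β s) := by
  have hβ₁ : β ≤ 1 := (le_mul_of_one_le_right hβ (by simp)).trans hdeg
  have pointwise (w : List T.edgeSet) :
      (if wordNulls hT c s w < n then (1 : ℝ) else 0)
        ≤ Real.exp (β / 8 * (potential T β s + 3 * n)) * Real.exp (β / 8 *
            (potential T β (runWord hT c s w) - potential T β s - 2 * wordNulls hT c s w)) := by
    split_ifs with hN
    · have hpot := neg_natCast_le_potential (T := T) hβ₁ (runWord hT c s w)
      rify at hN
      rw [← Real.exp_add, ← mul_add]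
      exact Real.one_le_exp (mul_nonneg (by positivity) (by linarith))
    · positivity
  calc _ ≤ Real.exp (β / 8 * (potential T β s + 3 * n)) * Real.exp (r * -(β ^ 2 / 16)) := by
        refine (wordMean_mono fun w _ => pointwise w).trans ?_
        rw [wordMean_const_mul]
        gcongr
        exact wordMean_exp_potential_runWord_le hT hc hβ hdeg r s
    _ = _ := by
        rw [← Real.exp_add, ← Real.exp_add]
        ring_nf

lemma wordMean_wordMean_wordNulls_lt_le (hc : 2 ≤ c) (hβ : 0 ≤ β)
    (hdeg : β * (T.maxDegree + 1) ≤ 1) {m : ℕ} (hm : 32 * n ≤ β ^ 2 * m) {a r : ℕ}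
    (ha : n ^ 2 * m ≤ a) (hr : 16 * (2 * n + m) ≤ β ^ 2 * r) (s : State n V) :
    wordMean a (fun u =>
        wordMean r fun w => if wordNulls hT c (runWord hT c s u) w < n then (1 : ℝ) else 0)
      ≤ 3 * Real.exp (-n) := by
  have hβ₁ : β ≤ 1 := (le_mul_of_one_le_right hβ (by simp)).trans hdeg
  calc _ ≤ Real.exp (3 / 8 * β * n - β ^ 2 / 16 * r) * (3 * Real.exp (β / 4 * m)) := by
        refine (wordMean_mono fun u _ => wordMean_wordNulls_lt_le hT hc hβ hdeg r _).trans ?_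
        rw [wordMean_const_mul]
        gcongr
        exact wordMean_exp_potential_le hT hc hβ hdeg hm ha s
    _ ≤ 3 * Real.exp (-n) := by
        rw [mul_left_comm, ← Real.exp_add]
        gcongr
        have hβn : β * n ≤ n := mul_le_of_le_one_left (Nat.cast_nonneg n) hβ₁
        have hβm : β * m ≤ m := mul_le_of_le_one_left (Nat.cast_nonneg m) hβ₁
        linarith

variable {Ω : Type*} [MeasurableSpace Ω] {μ : Measure Ω} {E : ℕ → Ω → T.edgeSet}

lemma IsRandomEvolver.measureReal_lt_card_labelsAt_le_of_window (hE : IsRandomEvolver T μ E)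
    (hc : 2 ≤ c) (hβ : 0 ≤ β) (hdeg : β * (T.maxDegree + 1) ≤ 1) {m : ℕ}
    (hm : 32 * n ≤ β ^ 2 * m) {a r : ℕ} (ha : n ^ 2 * m ≤ a)
    (hr : 16 * (2 * n + m) ≤ β ^ 2 * r) {t : ℕ} (ht : t / c = a + r) (s : State n V) (v : V)
    (x : ℝ) :
    μ.real {ω | x < (labelsAt (run hT c (fun i => E i ω) s t) v).card}
      ≤ 3 * Real.exp (-n)
        + Real.exp (r * (2 * T.degree v / Fintype.card T.edgeSet) + (c + 2 - x)) := by
  have indicator_le := hE.measureReal_le_wordMean (m := a + r)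
    (S := {ω | x < (labelsAt (run hT c (fun i => E i ω) s t) v).card})
    (F := fun w => (if wordNulls hT c (runWord hT c s (w.take a)) (w.drop a) < n then 1 else 0)
      + Real.exp (c + 2 - x) * Real.exp (swapCount v (w.drop a)))
    (fun w => by positivity) fun ω hω => ?_
  · calc _ ≤ wordMean a (fun u => wordMean r fun w =>
              if wordNulls hT c (runWord hT c s u) w < n then (1 : ℝ) else 0)
            + Real.exp (c + 2 - x)
              * wordMean r (fun w : List T.edgeSet => Real.exp (swapCount v w)) := by
          rw [← wordMean_const_mul, ← wordMean_const (α := T.edgeSet) a (wordMean r _),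
            ← wordMean_add]
          refine indicator_le.trans ?_
          rw [wordMean_append]
          refine wordMean_mono fun u hu => ?_
          simp only [List.take_left' hu, List.drop_left' hu, wordMean_add, le_rfl]
      _ ≤ _ := by
          rw [Real.exp_add, mul_comm (Real.exp (r * _))]
          gcongr
          · exact wordMean_wordMean_wordNulls_lt_le hT hc hβ hdeg hm ha hr s
          · exact wordMean_exp_swapCount_le v r
  · set w := List.ofFn fun i : Fin (a + r) => E i ω
    split_ifs with hN
    · exact le_add_of_nonneg_right (by positivity)
    · have hload := card_labelsAt_run_le hT (by omega) (fun i => E i ω) s t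
        (by rw [ht, List.take_append_drop]) (not_lt.mp hN) v
      rify at hload
      rw [zero_add, ← Real.exp_add]
      have : x < _ := hω
      exact Real.one_le_exp (by linarith)

/-- The number of rounds per label after which the exponential moment of the potential has
contracted: `32 / β ^ 2` for `β = 1 / (k + 1)`. -/
def contractionFactor (k : ℕ) : ℕ := 32 * (k + 1) ^ 2

/-- The number of rounds per label in which all labels are likely to be checked once the exponential
moment of the potential has contracted. -/
def windowFactor (k : ℕ) : ℕ := 16 * (k + 1) ^ 2 * (2 + contractionFactor k)

lemma IsRandomEvolver.measureReal_lt_card_labelsAt_le (hE : IsRandomEvolver T μ E) (hc : 2 ≤ c)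
    {k : ℕ} (hk : T.maxDegree ≤ k) {t : ℕ}
    (ht : c * (n ^ 2 * (contractionFactor k * n) + windowFactor k * n) ≤ t) (s : State n V) (v : V)
    (x : ℝ) :
    μ.real {ω | x < (labelsAt (run hT c (fun i => E i ω) s t) v).card}
      ≤ (3 + Real.exp (4 * k * windowFactor k + c + 2)) * Real.exp (-x) := by
  have := hE.indep.isProbabilityMeasure
  rcases le_or_gt (n : ℝ) x with hx | hx
  · have never : {ω | x < (labelsAt (run hT c (fun i => E i ω) s t) v).card} = ∅ := by
      refine Set.eq_empty_of_forall_notMem fun ω => not_lt.mpr (le_trans ?_ hx)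
      exact_mod_cast (Finset.card_le_univ _).trans_eq (Fintype.card_fin n)
    rw [never, measureReal_empty]
    positivity
  obtain ⟨a, ha⟩ : ∃ a, t / c = a + windowFactor k * n := by
    refine Nat.exists_eq_add_of_le' ?_
    rw [Nat.le_div_iff_mul_le (by omega), mul_comm]
    exact (Nat.mul_le_mul_left c (Nat.le_add_left _ _)).trans ht
  have ha' : n ^ 2 * (contractionFactor k * n) ≤ a := by
    rw [mul_comm, ← Nat.le_div_iff_mul_le (by omega), ha] at ht
    omega
  have hk' : (T.maxDegree : ℝ) ≤ k := mod_cast hk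
  have swap_rate_le := mul_two_mul_degree_div_card_edgeSet_le hT hk s v (windowFactor k)
  calc _ ≤ 3 * Real.exp (-n) + _ :=
        hE.measureReal_lt_card_labelsAt_le_of_window hT hc (β := 1 / (k + 1)) (by positivity)
          (by rw [one_div_mul_eq_div, div_le_one₀ (by positivity)]; linarith)
          (by simp only [contractionFactor]; push_cast; field_simp; rfl) ha'
          (by simp only [windowFactor]; push_cast; field_simp; rfl) ha s v x
    _ ≤ 3 * Real.exp (-x) + Real.exp (4 * k * windowFactor k + c + 2) * Real.exp (-x) := by
        rw [← Real.exp_add]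
        gcongr 3 * Real.exp ?_ + Real.exp ?_ <;> linarith
    _ = _ := by ring

end Tail

lemma mul_sq_mul_exp_le {A y : ℝ} (hA : 0 ≤ A) (hy : 1 ≤ y) :
    A * y ^ 2 * Real.exp (-((A + 3) * y)) ≤ Real.exp (-1 * y) := by
  have hA' : A ≤ Real.exp (A * y) := by nlinarith [Real.add_one_le_exp (A * y)]
  have hy' : y ≤ Real.exp y := by linarith [Real.add_one_le_exp y]
  calc A * y ^ 2 * Real.exp (-((A + 3) * y))
      ≤ Real.exp (A * y) * Real.exp y ^ 2 * Real.exp (-((A + 3) * y)) := by gcongr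
    _ = Real.exp (-1 * y) := by
        rw [← Real.exp_nat_mul, ← Real.exp_add, ← Real.exp_add]
        push_cast
        ring_nf

end EvolvingTree

open EvolvingTree in
theorem mainTheorem5_general (k c : ℕ) (hc : 2 ≤ c) :
    ∃ A : ℝ, 0 < A ∧ ∃ t₀ : ℕ → ℕ,
      ∀ (n : ℕ) (V : Type*) [Fintype V] [DecidableEq V]
        (T : SimpleGraph V) [DecidableRel T.Adj] (hT : T.IsTree), T.maxDegree ≤ k →
      ∀ (s₀ : State n V) (Ω : Type*) [MeasurableSpace Ω] (μ : Measure Ω)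
        (E : ℕ → Ω → T.edgeSet), IsRandomEvolver T μ E →
      ∀ t : ℕ, t₀ n ≤ t → ∀ x : ℝ,
        1 - A * n * Real.exp (-x) ≤
          μ.real {ω | ∀ v : V,
            ((labelsAt (run hT c (fun m => E m ω) s₀ t) v).card : ℝ) ≤ x} := by
  refine ⟨3 + Real.exp (4 * k * windowFactor k + c + 2), by positivity, fun n =>
    c * (n ^ 2 * (contractionFactor k * n) + windowFactor k * n), ?_⟩
  intro n V _ _ T _ hT hk s₀ Ω _ μ E hE t ht x
  have := hE.indep.isProbabilityMeasure
  obtain ⟨ω₀⟩ : Nonempty Ω := μ.nonempty_of_neZero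
  have : Nonempty T.edgeSet := ⟨E 0 ω₀⟩
  set load : Ω → V → ℕ := fun ω v => (labelsAt (run hT c (fun m => E m ω) s₀ t) v).card
  have overload_le : μ.real (⋃ v, {ω | x < load ω v})
      ≤ (3 + Real.exp (4 * k * windowFactor k + c + 2)) * n * Real.exp (-x) :=
    calc _ ≤ ∑ v, μ.real {ω | x < load ω v} := measureReal_iUnion_fintype_le _
      _ ≤ ∑ _v : V, _ := Finset.sum_le_sum fun v _ =>
          hE.measureReal_lt_card_labelsAt_le hT hc hk ht s₀ v x
      _ = _ := by
          rw [Finset.sum_const, Finset.card_univ, ← Fintype.card_congr s₀.trueLoc,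
            Fintype.card_fin, nsmul_eq_mul]
          ring
  have cover : {ω | ∀ v, (load ω v : ℝ) ≤ x} ∪ ⋃ v, {ω | x < load ω v} = Set.univ := by
    refine Set.eq_univ_of_forall fun ω => or_iff_not_imp_left.mpr fun hω => ?_
    simpa using hω
  have total := measureReal_union_le (μ := μ) {ω | ∀ v, (load ω v : ℝ) ≤ x}
    (⋃ v, {ω | x < load ω v})
  rw [cover, probReal_univ] at total
  linarith

open EvolvingTree in
theorem mainTheorem5 (k : ℕ) :
    ∃ C c : ℝ, 0 < C ∧ 0 < c ∧ ∃ t₀ : ℕ → ℕ,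
      ∀ (n : ℕ) [NeZero n] (V : Type*) [Fintype V] [DecidableEq V]
        (T : SimpleGraph V) [DecidableRel T.Adj] (hT : T.IsTree), T.maxDegree ≤ k →
      ∀ (M₀ : Fin n ≃ V) (H₀ : Fin n → V)
        (Ω : Type*) [MeasurableSpace Ω] (μ : Measure Ω) [IsProbabilityMeasure μ]
        (E : ℕ → Ω → T.edgeSet), IsRandomEvolver T μ E →
      ∀ t : ℕ, t₀ n ≤ t →
        1 - Real.exp (-c * √(n : ℝ)) ≤
          μ.real {ω | ∀ v : V,
            ((labelsAt (run hT 2 (fun m => E m ω) ⟨M₀, H₀, 0⟩ t) v).card : ℝ) ≤ C * √(n : ℝ)} := by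
  obtain ⟨A, hA, t₀, bound⟩ := mainTheorem5_general k 2 le_rfl
  refine ⟨A + 3, 1, by positivity, one_pos, t₀, ?_⟩
  intro n _ V _ _ T _ hT hk M₀ H₀ Ω _ μ _ E hE t ht
  have one_le_sqrt : 1 ≤ √(n : ℝ) := Real.one_le_sqrt.mpr (mod_cast NeZero.one_le)
  have tail_le := mul_sq_mul_exp_le hA.le one_le_sqrt
  rw [Real.sq_sqrt n.cast_nonneg] at tail_le
  linarith [bound n V T hT hk ⟨M₀, H₀, 0⟩ Ω μ E hE t ht ((A + 3) * √(n : ℝ))]
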